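/- Let $0<q<1$, let $A_i,\alpha_i>0$, $a_i\ge 0$ ($i=1,\dots,p$) and $B_j,\beta_j>0$, $b_j\ge 0$ ($j=1,\dots,s$) be real numbers. Let $$\Gamma_q(x)=(1-q)^{1-x}\prod_{n=0}^\infty\frac{1-q^{n+1}}{1-q^{x+n}},\qquad W_q(x)=\frac{\prod_{i=1}^p\Gamma_q(A_ix+a_i)^{\alpha_i}}{\prod_{j=1}^s\Gamma_q(B_jx+b_j)^{\beta_j}}\qquad(x>0).$$ Put $\hat{\mathcal A}=\{nA_i\log(1/q): n\ge1,\ 1\le i\le p\}$ and $\hat{\mathcal B}=\{mB_j\log(1/q): m\ge1,\ 1\le j\le s\}$ (as sets, $n,m$ integers), and define the non-negative discrete measures on $(0,\infty)$ $$\mu=\sum_{i=1}^p\sum_{n=1}^\infty\frac{n}{1-q^n}\alpha_iA_i^2q^{na_i}\,\delta_{nA_i\log(1/q)},\qquad \sigma=\sum_{j=1}^s\sum_{m=1}^\infty\frac{m}{1-q^m}\beta_jB_j^2q^{mb_j}\,\delta_{mB_j\log(1/q)}.$$ Both are finite on bounded sets, so $\tau=\mu-\sigma$ is a well-defined real-valued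 signed measure on bounded Borel sets; it is called non-negative, $\tau\ge0$, if $\tau(E)\ge0$ for every bounded Borel set $E$, and we write $\int f\,d\tau=\int f\,d\mu-\int f\,d\sigma$ when both integrals converge absolutely. A function $f$ on $(0,\infty)$ is completely monotonic if it is infinitely differentiable and $(-1)^nf^{(n)}(x)\ge0$ for all integers $n\ge0$ and all $x>0$. Then $W_q$ is positive and $\log W_q$ is infinitely differentiable on $(0,\infty)$, and the following hold. (a) For every $x>0$, the Laplace transforms of $\mu$ and $\sigma$ at $x$ converge and $$(\log W_q)''(x)=(\log q)^2\int_{(0,\infty)}e^{-xy}\,\tau(dy).$$ (b) $(\log W_q)''$ is completely monotonic if and only if $\tau\ge0$. (c) $\tau\ge0$ if and only if both of the following conditions hold: (1) $\hat{\mathcal B}\subset\hat{\mathcal A}$; (2) for each $t\in\hat{\mathcal B}$, $$\sum_{\substack{n\ge1,\ 1\le i\le p\\ nA_i\log(1/q)=t}}\frac{n}{1-q^n}\alpha_iA_i^2q^{na_i}\ \ge\sum_{\substack{m\ge1,\ 1\le j\le s\\ mB_j\log(1/q)=t}}\frac{m}{1-q^m}\beta_jB_j^2q^{mb_j}.$$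 (d) Condition (1) is equivalent to the existence of positive integers $n_1,\dots,n_s$ and (not necessarily distinct) indices $i_1,\dots,i_s\in\{1,\dots,p\}$ with $B_j=n_jA_{i_j}$ for $j=1,\dots,s$. (e) If $\tau\ge0$, then $\tau$ is the restriction to bounded Borel sets of a non-negative Borel measure, whose Laplace transform converges for every $x>0$, and with this measure in place of $\tau$ the formula in (a) is an integral against a non-negative measure. -/

import Mathlib

open scoped ContDiff

namespace QGammaRatio

/-- The `q`-gamma function
`Γ_q(x) = (1 - q)^(1 - x) * ∏_{n ≥ 0} (1 - q^(n+1)) / (1 - q^(x+n))`, for `0 < q < 1`, `x > 0`. -/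
noncomputable def qGamma (q x : ℝ) : ℝ :=
  (1 - q) ^ (1 - x) * ∏' n : ℕ, (1 - q ^ (n + 1)) / (1 - q ^ (x + (n : ℝ)))

/-- The infinite product defining `Γ_q` converges (unconditionally) for `0 < q < 1`, `x > 0`. -/
theorem multipliable_qGamma {q x : ℝ} (hq0 : 0 < q) (hq1 : q < 1) (hx : 0 < x) :
    Multipliable fun n : ℕ => (1 - q ^ (n + 1)) / (1 - q ^ (x + (n : ℝ))) := by
  have hqx : q ^ x < 1 := Real.rpow_lt_one hq0.le hq1 hx
  have hpos : 0 < 1 - q ^ x := by linarith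
  have key : ∀ n : ℕ, q ^ (x + (n : ℝ)) = q ^ x * q ^ n := fun n => by
    rw [Real.rpow_add hq0, Real.rpow_natCast]
  have hden : ∀ n : ℕ, 1 - q ^ x ≤ 1 - q ^ x * q ^ n := fun n => by
    have h1 : q ^ n ≤ 1 := pow_le_one₀ hq0.le hq1.le
    have h2 : 0 < q ^ x := Real.rpow_pos_of_pos hq0 x
    nlinarith
  have hs : Summable fun n : ℕ => (q ^ x - q) * q ^ n / (1 - q ^ x * q ^ n) := by
    refine Summable.of_norm_bounded (g := fun n : ℕ => |q ^ x - q| / (1 - q ^ x) * q ^ n)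
      ((summable_geometric_of_lt_one hq0.le hq1).mul_left _) fun n => ?_
    have hd := hden n
    have hp : 0 < 1 - q ^ x * q ^ n := by linarith
    rw [Real.norm_eq_abs, abs_div, abs_mul, abs_of_pos hp, abs_of_pos (pow_pos hq0 n),
      div_mul_eq_mul_div]
    gcongr
  refine (Real.multipliable_one_add_of_summable hs).congr fun n => ?_
  have hp : 0 < 1 - q ^ x * q ^ n := by linarith [hden n]
  rw [key n, pow_succ]
  field_simp
  ring

/-- The ratio
`W_q(x) = ∏ i, Γ_q(A i x + a i)^(α i) / ∏ j, Γ_q(B j x + b j)^(β j)`. -/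
noncomputable def ratioW (q : ℝ) {p s : ℕ} (A α a : Fin p → ℝ) (B β b : Fin s → ℝ) (x : ℝ) : ℝ :=
  (∏ i, qGamma q (A i * x + a i) ^ α i) / ∏ j, qGamma q (B j * x + b j) ^ β j

/-- The second derivative `(log W_q)''`. -/
noncomputable def logW'' (q : ℝ) {p s : ℕ} (A α a : Fin p → ℝ) (B β b : Fin s → ℝ) : ℝ → ℝ :=
  iteratedDeriv 2 fun x => Real.log (ratioW q A α a B β b x)

/-- Completely monotonic functions on `(0, ∞)`: smooth, with `(-1)^n f^(n) ≥ 0` for all `n ≥ 0`.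
The values of `f` on `(-∞, 0]` are irrelevant. -/
def CompletelyMonotonic (f : ℝ → ℝ) : Prop :=
  ContDiffOn ℝ ∞ f (Set.Ioi 0) ∧
    ∀ n : ℕ, ∀ x : ℝ, 0 < x → 0 ≤ (-1) ^ n * iteratedDeriv n f x

/-- The set of the points `n * A i * log (1/q)`, `n ≥ 1`, `i = 1, …, p`, without repetitions. -/
def massPoints (q : ℝ) {p : ℕ} (A : Fin p → ℝ) : Set ℝ :=
  {t | ∃ (n : ℕ+) (i : Fin p), (n : ℝ) * A i * Real.log (1 / q) = t}

/-- The mass `n / (1 - q^n) * α i * (A i)^2 * q^(n * a i)`. -/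
noncomputable def mass (q : ℝ) {p : ℕ} (A α a : Fin p → ℝ) (n : ℕ+) (i : Fin p) : ℝ :=
  (n : ℝ) / (1 - q ^ (n : ℕ)) * α i * A i ^ 2 * q ^ ((n : ℝ) * a i)

/-- The discrete measure
`∑ i, ∑_{n ≥ 1} n / (1 - q^n) * α i * (A i)^2 * q^(n * a i) * δ_{n * A i * log (1/q)}`.
It has infinite total mass when some `a i` is zero. -/
noncomputable def discreteMeasure (q : ℝ) {p : ℕ} (A α a : Fin p → ℝ) : MeasureTheory.Measure ℝ :=
  ∑ i, MeasureTheory.Measure.sum fun n : ℕ+ =>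
    ENNReal.ofReal (mass q A α a n i) •
      MeasureTheory.Measure.dirac ((n : ℝ) * A i * Real.log (1 / q))

/-- The sum of the masses `n / (1 - q^n) * α i * (A i)^2 * q^(n * a i)` over the (finitely many)
pairs `(n, i)` with `n * A i * log (1/q) = t`. -/
noncomputable def massAt (q : ℝ) {p : ℕ} (A α a : Fin p → ℝ) (t : ℝ) : ℝ :=
  ∑' x : {x : ℕ+ × Fin p // (x.1 : ℝ) * A x.2 * Real.log (1 / q) = t}, mass q A α a x.1.1 x.1.2

/-- The signed measure `τ = μ - σ` as a set function on bounded Borel sets, for `μ`, `σ` finite on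
bounded sets. (Both may be infinite on unbounded sets, where `μ - σ` has no meaning.) -/
noncomputable def diffMeasure (μ σ : MeasureTheory.Measure ℝ) (E : Set ℝ) : ℝ :=
  (μ E).toReal - (σ E).toReal

/-- `τ = μ - σ` is a non-negative measure: `τ(E) ≥ 0` for every bounded Borel set `E`. -/
def DiffNonneg (μ σ : MeasureTheory.Measure ℝ) : Prop :=
  ∀ E : Set ℝ, MeasurableSet E → Bornology.IsBounded E → 0 ≤ diffMeasure μ σ E

/-- The Laplace transform `∫_{(0,∞)} e^{-xy} ν(dy)` of a measure `ν`. -/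
noncomputable def laplace (ν : MeasureTheory.Measure ℝ) (x : ℝ) : ℝ :=
  ∫ y in Set.Ioi (0 : ℝ), Real.exp (-(x * y)) ∂ν

/-- The integral defining the Laplace transform of `ν` at `x` converges absolutely. -/
def LaplaceConverges (ν : MeasureTheory.Measure ℝ) (x : ℝ) : Prop :=
  MeasureTheory.IntegrableOn (fun y : ℝ => Real.exp (-(x * y))) (Set.Ioi 0) ν

end QGammaRatio

/-!
The proof rests on the expansion
`log Γ_q(x) = (1 - x) log (1 - q) + G(x) - G(1)`, `G(x) = ∑_{k ≥ 1} q^{k x} / (k (1 - q^k))`,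
which follows by expanding each `-log (1 - q^{x + n})` in powers of `q^{x + n}` and interchanging
the sums (`hasSum_neg_log_one_sub`, `qGamma_eq_exp`). Since `q^{k x} = e^{-x k log (1/q)}`,
`log W_q` is an affine function plus the difference of two exponential series `∑ c e^{-x l}` with
rates `n A i log (1/q)` and `m B j log (1/q)`. Such a series, once it converges at every `x > 0`,
may be differentiated term by term any number of times (`ExpSummable.hasDerivAt`); two
differentiations turn its coefficients into `(log q)^2` times the masses of `μ` and `σ`
(`neg_rate_sq_mul_logCoeff`, `logW''_eq`), which is the Laplace representation.

Non-negativity of `τ = μ - σ` is a condition on atoms: both measures are carried by a countable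
set, so if `σ {t} ≤ μ {t}` for every `t`, then `μ = τ + σ` for the measure `τ` with atoms
`μ {t} - σ {t}` (`exists_add_eq_of_countable`). This measure extends `τ` from the bounded sets, and
`(log W_q)''` is its Laplace transform up to the factor, hence completely monotonic.

Conversely, an atom is recovered from the derivatives of the Laplace transform by a Post–Widder
limit (`ExpSummable.tendsto_coefficient`): the `n`-th derivative at `n / t`, scaled by `(e / t)^n`,
weights the atom at `l` by `(u e^{1 - u})^n` with `u = l / t`. The function `u e^{1 - u}` has its
strict maximum `1` at `u = 1`, so by dominated convergence only the atom at `t` survives as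
`n → ∞`, and complete monotonicity makes the limit `μ {t} - σ {t}` non-negative. No uniqueness
theorem for Laplace transforms is needed.
-/

namespace QGammaRatio

open Filter Topology MeasureTheory

/-! ### Exponential series -/

/-- The exponential series `∑ c k * e^{-x l k}` with coefficients `c` and rates `l`. -/
noncomputable def expSeries {ι : Type*} (c l : ι → ℝ) (x : ℝ) : ℝ :=
  ∑' k, c k * Real.exp (-(x * l k))

/-- Convergence of the exponential series with coefficients `c` and rates `l` at every `x > 0`
(absolute convergence, as for every summable real family). -/
def ExpSummable {ι : Type*} (c l : ι → ℝ) : Prop :=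
  ∀ x : ℝ, 0 < x → Summable fun k => c k * Real.exp (-(x * l k))

variable {ι : Type*} {c l : ι → ℝ}

theorem mul_exp_neg_mul_le {x t : ℝ} (hx : 0 < x) : t * Real.exp (-(x * t)) ≤ 1 / x := by
  have h := Real.mul_exp_neg_le_exp_neg_one (x * t)
  have h1 : Real.exp (-1) ≤ 1 := Real.exp_le_one_iff.2 (by norm_num)
  rw [le_div_iff₀ hx]
  linarith

/-- Term-by-term differentiation preserves convergence: half of the exponential decay absorbs
the factor `l k`. -/
theorem ExpSummable.neg_mul (hl : ∀ k, 0 ≤ l k) (h : ExpSummable c l) :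
    ExpSummable (fun k => -l k * c k) l := by
  intro x hx
  refine Summable.of_norm_bounded (g := fun k => 1 / (x / 2) * |c k * Real.exp (-(x / 2 * l k))|)
    ((h (x / 2) (half_pos hx)).abs.mul_left _) fun k => ?_
  have h1 := mul_exp_neg_mul_le (t := l k) (half_pos hx)
  have h2 : Real.exp (-(x * l k)) = Real.exp (-(x / 2 * l k)) * Real.exp (-(x / 2 * l k)) := by
    rw [← Real.exp_add]; ring_nf
  rw [Real.norm_eq_abs, h2, abs_mul, abs_mul, abs_mul, abs_mul, abs_neg, abs_of_nonneg (hl k),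
    Real.abs_exp]
  calc l k * |c k| * (Real.exp (-(x / 2 * l k)) * Real.exp (-(x / 2 * l k)))
      = l k * Real.exp (-(x / 2 * l k)) * (|c k| * Real.exp (-(x / 2 * l k))) := by ring
    _ ≤ _ := by gcongr

theorem ExpSummable.neg_pow_mul (hl : ∀ k, 0 ≤ l k) (h : ExpSummable c l) (n : ℕ) :
    ExpSummable (fun k => (-l k) ^ n * c k) l := by
  induction n with
  | zero => simpa using h
  | succ n ih =>
    have := ih.neg_mul hl
    simpa only [pow_succ', mul_assoc] using this

theorem ExpSummable.hasDerivAt (hl : ∀ k, 0 ≤ l k) (h : ExpSummable c l) {x : ℝ} (hx : 0 < x) :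
    HasDerivAt (expSeries c l) (expSeries (fun k => -l k * c k) l x) x := by
  refine hasDerivAt_tsum_of_isPreconnected (t := Set.Ioi (x / 2)) (y₀ := x)
    (u := fun k => |-l k * c k * Real.exp (-(x / 2 * l k))|)
    (g := fun k y => c k * Real.exp (-(y * l k)))
    (g' := fun k y => -l k * c k * Real.exp (-(y * l k)))
    ((h.neg_mul hl) (x / 2) (half_pos hx)).abs isOpen_Ioi isPreconnected_Ioi
    (fun k y _ => ?_) (fun k y hy => ?_) (half_lt_self hx) (h x hx) (half_lt_self hx)
  · rw [show -l k * c k * Real.exp (-(y * l k)) = c k * (Real.exp (-(y * l k)) * -l k) by ring]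
    exact ((hasDerivAt_mul_const (l k)).neg.exp).const_mul (c k)
  · rw [Real.norm_eq_abs, abs_mul, abs_mul (-l k * c k), Real.abs_exp, Real.abs_exp]
    have := hl k
    have hy' : x / 2 ≤ y := le_of_lt hy
    gcongr

theorem ExpSummable.contDiffOn (hl : ∀ k, 0 ≤ l k) (h : ExpSummable c l) :
    ContDiffOn ℝ ∞ (expSeries c l) (Set.Ioi 0) := by
  refine contDiffOn_infty.2 fun n => ?_
  induction n generalizing c with
  | zero =>
    exact contDiffOn_zero.2 fun x hx => (h.hasDerivAt hl hx).continuousAt.continuousWithinAt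
  | succ n ih =>
    rw [Nat.cast_add, Nat.cast_one, contDiffOn_succ_iff_deriv_of_isOpen isOpen_Ioi]
    refine ⟨fun x hx => (h.hasDerivAt hl hx).differentiableAt.differentiableWithinAt,
      by simp, (ih (h.neg_mul hl)).congr fun x hx => (h.hasDerivAt hl hx).deriv⟩

theorem ExpSummable.iteratedDeriv_eq (hl : ∀ k, 0 ≤ l k) (h : ExpSummable c l) (n : ℕ) {x : ℝ}
    (hx : 0 < x) :
    iteratedDeriv n (expSeries c l) x = expSeries (fun k => (-l k) ^ n * c k) l x := by
  induction n generalizing x with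
  | zero => simp
  | succ n ih =>
    have he : iteratedDeriv n (expSeries c l) =ᶠ[𝓝 x] expSeries (fun k => (-l k) ^ n * c k) l :=
      (eventually_gt_nhds hx).mono fun y hy => ih hy
    rw [iteratedDeriv_succ, he.deriv_eq, ((h.neg_pow_mul hl n).hasDerivAt hl hx).deriv]
    simp only [pow_succ', mul_assoc]

theorem ExpSummable.pow_mul (hl : ∀ k, 0 < l k) (h : ExpSummable c l) (n : ℕ) :
    ExpSummable (fun k => l k ^ n * c k) l := by
  intro x hx
  refine ((h.neg_pow_mul (fun k => (hl k).le) n x hx).mul_left ((-1) ^ n)).congr fun k => ?_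
  rw [← mul_assoc, ← mul_assoc, ← mul_pow, neg_one_mul, neg_neg]

theorem ExpSummable.contDiffAt (hl : ∀ k, 0 < l k) (h : ExpSummable c l) (n : ℕ) {x : ℝ}
    (hx : 0 < x) : ContDiffAt ℝ n (expSeries c l) x :=
  ((h.contDiffOn fun k => (hl k).le).contDiffAt (Ioi_mem_nhds hx)).of_le
    (by exact_mod_cast le_top)

theorem ExpSummable.neg_one_pow_mul_iteratedDeriv (hl : ∀ k, 0 < l k) (h : ExpSummable c l)
    (n : ℕ) {x : ℝ} (hx : 0 < x) :
    (-1) ^ n * iteratedDeriv n (expSeries c l) x = expSeries (fun k => l k ^ n * c k) l x := by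
  rw [h.iteratedDeriv_eq (fun k => (hl k).le) n hx, expSeries, expSeries, ← tsum_mul_left]
  refine tsum_congr fun k => ?_
  rw [← mul_assoc, ← mul_assoc, ← mul_pow, neg_one_mul, neg_neg]

/-- The peak function `u e^{1-u}` is less than `1` away from its maximum `u = 1`. -/
theorem mul_exp_one_sub_lt_one {u : ℝ} (hu : u ≠ 1) : u * Real.exp (1 - u) < 1 := by
  have h1 := Real.add_one_lt_exp (sub_ne_zero.2 hu)
  have h2 : Real.exp (u - 1) * Real.exp (1 - u) = 1 := by rw [← Real.exp_add]; simp
  nlinarith [Real.exp_pos (1 - u)]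

/-- Recovery of a coefficient of an exponential series from its derivatives (the Post–Widder
inversion): after scaling by `(e / t)^n`, the term with rate `l k` of the `n`-th derivative at
`n / t` is `c k * (u e^{1-u})^n` with `u = l k / t`, and only the rate `t` survives. -/
theorem ExpSummable.tendsto_coefficient (hl : ∀ k, 0 ≤ l k) (h : ExpSummable c l) {t : ℝ}
    (ht : 0 < t) :
    Tendsto (fun n : ℕ => (Real.exp 1 / t) ^ n *
        expSeries (fun k => l k ^ n * c k) l (n / t)) atTop
      (𝓝 (∑' k, {k | l k = t}.indicator c k)) := by
  have hterm : ∀ (n : ℕ) (k : ι), (Real.exp 1 / t) ^ n *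
      (l k ^ n * c k * Real.exp (-(n / t * l k))) =
        c k * (l k / t * Real.exp (1 - l k / t)) ^ n := by
    intro n k
    have : Real.exp (-(n / t * l k)) = Real.exp (-(l k / t)) ^ n := by
      rw [← Real.exp_nat_mul]; congr 1; ring
    rw [this, sub_eq_add_neg, Real.exp_add, mul_pow, mul_pow, div_pow, div_pow]
    ring
  simp only [expSeries, ← tsum_mul_left, hterm]
  -- For `n ≥ 1` the terms are dominated by those of `n = 1`, the first derivative at `1 / t`.
  have hsum := ((h.neg_mul hl) (1 / t) (by positivity)).abs.mul_left (Real.exp 1 / t)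
  refine tendsto_tsum_of_dominated_convergence hsum (fun k => ?_) ?_
  · by_cases hk : l k = t
    · simp [hk, ht.ne']
    · rw [Set.indicator_of_notMem (by simpa using hk)]
      have h0 : 0 ≤ l k / t * Real.exp (1 - l k / t) :=
        mul_nonneg (div_nonneg (hl k) ht.le) (Real.exp_pos _).le
      have h1 : l k / t * Real.exp (1 - l k / t) < 1 :=
        mul_exp_one_sub_lt_one fun he => hk ((div_eq_one_iff_eq ht.ne').1 he)
      simpa using (tendsto_pow_atTop_nhds_zero_of_lt_one h0 h1).const_mul (c k)
  · filter_upwards [eventually_ge_atTop 1] with n hn k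
    have h0 : 0 ≤ l k / t * Real.exp (1 - l k / t) :=
      mul_nonneg (div_nonneg (hl k) ht.le) (Real.exp_pos _).le
    have h1 : l k / t * Real.exp (1 - l k / t) ≤ 1 := by
      by_cases hk : l k / t = 1
      · simp [hk]
      · exact (mul_exp_one_sub_lt_one hk).le
    rw [Real.norm_eq_abs, abs_mul, abs_of_nonneg (pow_nonneg h0 n), abs_mul, abs_mul, abs_neg,
      abs_of_nonneg (hl k), Real.abs_exp]
    calc |c k| * (l k / t * Real.exp (1 - l k / t)) ^ n
        ≤ |c k| * (l k / t * Real.exp (1 - l k / t)) := by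
          gcongr
          exact pow_le_of_le_one h0 h1 (by omega)
      _ = _ := by
          rw [sub_eq_add_neg, Real.exp_add, one_div_mul_eq_div]
          ring

/-! ### Discrete measures -/

/-- The measure `∑ c k * δ_{l k}`, for non-negative weights `c`. -/
noncomputable def atomicMeasure (c l : ι → ℝ) : Measure ℝ :=
  Measure.sum fun k => ENNReal.ofReal (c k) • Measure.dirac (l k)

theorem atomicMeasure_compl_range [Countable ι] : atomicMeasure c l (Set.range l)ᶜ = 0 := by
  have hm : MeasurableSet (Set.range l)ᶜ := (Set.countable_range l).measurableSet.compl
  simp [atomicMeasure, Measure.sum_apply _ hm]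

theorem integrable_atomicMeasure [Countable ι] (hc : ∀ k, 0 ≤ c k) {f : ℝ → ℝ}
    (hf : Summable fun k => c k * f (l k)) : Integrable f (atomicMeasure c l) := by
  refine integrable_sum_dirac (fun _ => ENNReal.ofReal_ne_top) (hf.abs.congr fun k => ?_)
  rw [abs_mul, ENNReal.toReal_ofReal (hc k), abs_of_nonneg (hc k), Real.norm_eq_abs]

theorem integral_atomicMeasure [Countable ι] (hc : ∀ k, 0 ≤ c k) {f : ℝ → ℝ}
    (hf : Summable fun k => c k * f (l k)) :
    ∫ y, f y ∂atomicMeasure c l = ∑' k, c k * f (l k) := by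
  rw [atomicMeasure, integral_sum_measure (integrable_atomicMeasure hc hf)]
  simp [integral_smul_measure, ENNReal.toReal_ofReal (hc _)]

/-- Bounded sets have finite measure, since `c k ≤ e^R * (c k * e^{-l k})` whenever `l k ≤ R`. -/
theorem atomicMeasure_lt_top (hc : ∀ k, 0 ≤ c k) (h : ExpSummable c l) {E : Set ℝ}
    (hE : Bornology.IsBounded E) : atomicMeasure c l E < ⊤ := by
  -- Only the upper bound matters: the exponential weight controls every `Set.Iic R`.
  obtain ⟨R, hR⟩ := hE.bddAbove
  have hsum : Summable fun k => c k * Real.exp (-(1 * l k)) := h 1 one_pos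
  refine (measure_mono (t := Set.Iic R) hR).trans_lt ?_
  rw [atomicMeasure, Measure.sum_apply _ measurableSet_Iic]
  refine (ENNReal.tsum_le_tsum (g := fun k =>
    ENNReal.ofReal (Real.exp R * (c k * Real.exp (-(1 * l k))))) fun k => ?_).trans_lt
      (hsum.mul_left _).tsum_ofReal_lt_top
  by_cases hk : l k ≤ R
  · simp only [Measure.smul_apply, smul_eq_mul]
    rw [Measure.dirac_apply' _ measurableSet_Iic, Set.indicator_of_mem (by simpa using hk)]
    simp only [Pi.one_apply, mul_one]
    refine ENNReal.ofReal_le_ofReal ?_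
    have h1 : 1 ≤ Real.exp R * Real.exp (-(1 * l k)) := by
      rw [← Real.exp_add]; exact Real.one_le_exp (by linarith)
    nlinarith [hc k]
  · simp [Measure.dirac_apply' _ measurableSet_Iic, hk]

theorem atomicMeasure_singleton (hc : ∀ k, 0 ≤ c k) (h : ExpSummable c l) (t : ℝ) :
    atomicMeasure c l {t} = ENNReal.ofReal (∑' k, {k | l k = t}.indicator c k) := by
  have hi : Summable fun k => {k | l k = t}.indicator c k := by
    refine Summable.of_norm_bounded ((h 1 one_pos).mul_left (Real.exp t)) fun k => ?_
    by_cases hk : l k = t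
    · rw [Set.indicator_of_mem (by simpa using hk), hk, Real.norm_eq_abs, abs_of_nonneg (hc k)]
      have : Real.exp t * Real.exp (-(1 * t)) = 1 := by rw [← Real.exp_add]; simp
      nlinarith [hc k]
    · rw [Set.indicator_of_notMem (by simpa using hk)]
      simpa using mul_nonneg (Real.exp_pos t).le (mul_nonneg (hc k) (Real.exp_pos _).le)
  rw [ENNReal.ofReal_tsum_of_nonneg (fun k => Set.indicator_nonneg (fun k _ => hc k) k) hi,
    atomicMeasure, Measure.sum_apply _ (measurableSet_singleton t)]
  refine tsum_congr fun k => ?_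
  by_cases hk : l k = t <;> simp [hk]

/-- All points of the measure are positive, so restriction to `(0, ∞)` loses nothing. -/
theorem atomicMeasure_restrict_Ioi [Countable ι] (hl : ∀ k, 0 < l k) :
    (atomicMeasure c l).restrict (Set.Ioi 0) = atomicMeasure c l := by
  refine Measure.restrict_eq_self_of_ae_mem (measure_mono_null (fun y hy => ?_)
    (atomicMeasure_compl_range (c := c) (l := l)))
  rintro ⟨k, rfl⟩
  exact hy (hl k)

theorem integrableOn_pow_mul_exp [Countable ι] (hc : ∀ k, 0 ≤ c k) (hl : ∀ k, 0 < l k)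
    (h : ExpSummable c l) (n : ℕ) {x : ℝ} (hx : 0 < x) :
    IntegrableOn (fun y => y ^ n * Real.exp (-(x * y))) (Set.Ioi 0) (atomicMeasure c l) := by
  rw [IntegrableOn, atomicMeasure_restrict_Ioi hl]
  refine integrable_atomicMeasure hc ((h.pow_mul hl n x hx).congr fun k => ?_)
  ring

theorem setIntegral_pow_mul_exp [Countable ι] (hc : ∀ k, 0 ≤ c k) (hl : ∀ k, 0 < l k)
    (h : ExpSummable c l) (n : ℕ) {x : ℝ} (hx : 0 < x) :
    ∫ y in Set.Ioi 0, y ^ n * Real.exp (-(x * y)) ∂atomicMeasure c l =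
      expSeries (fun k => l k ^ n * c k) l x := by
  have he : ∀ k, l k ^ n * c k * Real.exp (-(x * l k)) = c k * (l k ^ n * Real.exp (-(x * l k))) :=
    fun k => by ring
  rw [atomicMeasure_restrict_Ioi hl, integral_atomicMeasure hc
    ((h.pow_mul hl n x hx).congr he)]
  exact tsum_congr fun k => (he k).symm

theorem laplaceConverges_atomicMeasure [Countable ι] (hc : ∀ k, 0 ≤ c k) (hl : ∀ k, 0 < l k)
    (h : ExpSummable c l) {x : ℝ} (hx : 0 < x) : LaplaceConverges (atomicMeasure c l) x := by
  simpa [LaplaceConverges] using integrableOn_pow_mul_exp hc hl h 0 hx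

theorem laplace_atomicMeasure [Countable ι] (hc : ∀ k, 0 ≤ c k) (hl : ∀ k, 0 < l k)
    (h : ExpSummable c l) {x : ℝ} (hx : 0 < x) :
    laplace (atomicMeasure c l) x = expSeries c l x := by
  simpa [laplace] using setIntegral_pow_mul_exp hc hl h 0 hx

/-! ### The difference of two measures -/

/-- A measure carried by a countable set is the sum of its atoms. -/
theorem eq_sum_dirac_of_countable {ν : Measure ℝ} {S : Set ℝ} (hS : S.Countable)
    (hν : ν Sᶜ = 0) : ν = Measure.sum fun t : S => ν {(t : ℝ)} • Measure.dirac (t : ℝ) := by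
  have := hS.to_subtype
  have h1 : ν.restrict S = ν := Measure.restrict_eq_self_of_ae_mem (by
    rw [ae_iff]; exact hν)
  have h2 : S = ⋃ t : S, {(t : ℝ)} := by ext; simp
  conv_lhs => rw [← h1, h2]
  rw [Measure.restrict_iUnion (fun i j hij => by
    simpa [Function.onFun] using fun h => hij (Subtype.ext h)) (fun _ => measurableSet_singleton _)]
  simp_rw [Measure.restrict_singleton]

/-- If `σ ≤ μ` on singletons and both measures are carried by a countable set, then `μ - σ` exists
as a measure, even if `μ` and `σ` are infinite. -/
theorem exists_add_eq_of_countable {μ σ : Measure ℝ} {S : Set ℝ} (hS : S.Countable)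
    (hμ : μ Sᶜ = 0) (hσ : σ Sᶜ = 0) (h : ∀ t, σ {t} ≤ μ {t}) :
    ∃ τ : Measure ℝ, τ + σ = μ := by
  refine ⟨Measure.sum fun t : S => (μ {(t : ℝ)} - σ {(t : ℝ)}) • Measure.dirac (t : ℝ), ?_⟩
  refine (congrArg _ (eq_sum_dirac_of_countable hS hσ)).trans
    (Eq.trans ?_ (eq_sum_dirac_of_countable hS hμ).symm)
  rw [Measure.sum_add_sum]
  congr 1
  funext t
  rw [← add_smul, tsub_add_cancel_of_le (h t)]

theorem diffNonneg_of_add_eq {μ σ τ : Measure ℝ}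
    (hμ : ∀ E : Set ℝ, Bornology.IsBounded E → μ E < ⊤) (h : τ + σ = μ) : DiffNonneg μ σ := by
  intro E _ hE
  refine sub_nonneg.2 (ENNReal.toReal_mono (hμ E hE).ne ?_)
  rw [← h]
  exact le_add_self

theorem apply_eq_ofReal_diffMeasure {μ σ τ : Measure ℝ} (h : τ + σ = μ) {E : Set ℝ}
    (hE : μ E < ⊤) : τ E = ENNReal.ofReal (diffMeasure μ σ E) := by
  rw [← h, Measure.add_apply] at hE
  have h1 : τ E ≠ ⊤ := (le_self_add.trans_lt hE).ne
  have h2 : σ E ≠ ⊤ := (le_add_self.trans_lt hE).ne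
  rw [diffMeasure, ← h, Measure.add_apply, ENNReal.toReal_add h1 h2, add_sub_cancel_right,
    ENNReal.ofReal_toReal h1]

theorem laplace_eq_sub_of_add_eq {μ σ τ : Measure ℝ} (h : τ + σ = μ) {x : ℝ}
    (hμ : LaplaceConverges μ x) :
    LaplaceConverges τ x ∧ laplace τ x = laplace μ x - laplace σ x := by
  subst h
  rw [LaplaceConverges, IntegrableOn, Measure.restrict_add, integrable_add_measure] at hμ
  refine ⟨hμ.1, ?_⟩
  rw [laplace, laplace, laplace, Measure.restrict_add, integral_add_measure hμ.1 hμ.2,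
    add_sub_cancel_right]

/-! ### The logarithm of the `q`-gamma function as an exponential series -/

/-- The coefficients `1 / (k (1 - q^k))` of the series of `log Γ_q`. -/
noncomputable def gammaCoeff (q : ℝ) (k : ℕ+) : ℝ := 1 / (k * (1 - q ^ (k : ℕ)))

/-- The rates `k log (1/q)`, so that `e^{-x * gammaRate q k} = q^{k x}`. -/
noncomputable def gammaRate (q : ℝ) (k : ℕ+) : ℝ := k * Real.log (1 / q)

/-- The series `∑_{k ≥ 1} q^{k x} / (k (1 - q^k)) = -∑_{n ≥ 0} log (1 - q^{x + n})`. -/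
noncomputable def gammaSeries (q : ℝ) : ℝ → ℝ := expSeries (gammaCoeff q) (gammaRate q)

variable {q : ℝ}

theorem one_sub_pow_pnat_pos (hq0 : 0 < q) (hq1 : q < 1) (k : ℕ+) : 0 < 1 - q ^ (k : ℕ) :=
  sub_pos.2 (pow_lt_one₀ hq0.le hq1 k.ne_zero)

theorem gammaCoeff_pos (hq0 : 0 < q) (hq1 : q < 1) (k : ℕ+) : 0 < gammaCoeff q k := by
  have := one_sub_pow_pnat_pos hq0 hq1 k
  have : (0 : ℝ) < k := by exact_mod_cast k.pos
  unfold gammaCoeff; positivity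

theorem exp_neg_mul_gammaRate (hq0 : 0 < q) (x : ℝ) (k : ℕ+) :
    Real.exp (-(x * gammaRate q k)) = (q ^ x) ^ (k : ℕ) := by
  rw [gammaRate, Real.rpow_def_of_pos hq0, ← Real.exp_nat_mul, one_div, Real.log_inv]
  congr 1; ring

theorem expSummable_gamma (hq0 : 0 < q) (hq1 : q < 1) :
    ExpSummable (gammaCoeff q) (gammaRate q) := by
  intro x hx
  have hqx0 : 0 < q ^ x := Real.rpow_pos_of_pos hq0 x
  have hqx : q ^ x < 1 := Real.rpow_lt_one hq0.le hq1 hx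
  refine Summable.of_norm_bounded (g := fun k : ℕ+ => 1 / (1 - q) * (q ^ x) ^ (k : ℕ))
    (((summable_geometric_of_lt_one hqx0.le hqx).comp_injective PNat.coe_injective).mul_left _)
    fun k => ?_
  have hc := gammaCoeff_pos hq0 hq1 k
  rw [exp_neg_mul_gammaRate hq0, Real.norm_eq_abs, abs_of_nonneg (by positivity)]
  have h1 : 1 - q ≤ k * (1 - q ^ (k : ℕ)) := by
    have h2 : q ^ (k : ℕ) ≤ q := pow_le_of_le_one hq0.le hq1.le k.ne_zero
    have h3 : (1 : ℝ) ≤ k := by exact_mod_cast Nat.succ_le_of_lt k.pos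
    nlinarith
  have h4 : gammaCoeff q k ≤ 1 / (1 - q) := one_div_le_one_div_of_le (sub_pos.2 hq1) h1
  gcongr

/-- Expansion of each logarithm and interchange of the two summations (all terms are
non-negative). -/
theorem hasSum_neg_log_one_sub (hq0 : 0 < q) (hq1 : q < 1) {x : ℝ} (hx : 0 < x) :
    HasSum (fun n : ℕ => -Real.log (1 - q ^ (x + (n : ℝ)))) (gammaSeries q x) := by
  have hqx0 : 0 < q ^ x := Real.rpow_pos_of_pos hq0 x
  let f : ℕ+ × ℕ → ℝ := fun z => (q ^ (x + (z.2 : ℝ))) ^ (z.1 : ℕ) / z.1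
  have hf0 : 0 ≤ f := fun z => by
    have : 0 < q ^ (x + (z.2 : ℝ)) := Real.rpow_pos_of_pos hq0 _
    simp only [f, Pi.zero_apply]; positivity
  have hcol : ∀ k : ℕ+,
      HasSum (fun n => f (k, n)) (gammaCoeff q k * Real.exp (-(x * gammaRate q k))) := by
    intro k
    have hk := one_sub_pow_pnat_pos hq0 hq1 k
    have hk0 : (0 : ℝ) < k := by exact_mod_cast k.pos
    have h := (hasSum_geometric_of_lt_one (pow_pos hq0 (k : ℕ)).le
      (sub_pos.1 hk)).mul_left ((q ^ x) ^ (k : ℕ) / k)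
    rw [exp_neg_mul_gammaRate hq0, gammaCoeff]
    convert! h using 1
    · funext n
      simp only [f]
      rw [Real.rpow_add hq0, Real.rpow_natCast, mul_pow, ← pow_mul, ← pow_mul, mul_comm n]
      ring
    · field_simp
  have hrow : ∀ n : ℕ, HasSum (fun k => f (k, n)) (-Real.log (1 - q ^ (x + (n : ℝ)))) := by
    intro n
    have h0 : 0 < q ^ (x + (n : ℝ)) := Real.rpow_pos_of_pos hq0 _
    have h1 : q ^ (x + (n : ℝ)) < 1 := Real.rpow_lt_one hq0.le hq1 (by positivity)
    have h := Real.hasSum_pow_div_log_of_abs_lt_one (by rwa [abs_of_pos h0])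
    rw [← Equiv.pnatEquivNat.symm.hasSum_iff]
    convert! h using 1
    funext m
    simp [f]
  have hs : Summable f := (summable_prod_of_nonneg hf0).2 ⟨fun k => (hcol k).summable, by
    simp_rw [fun k => (hcol k).tsum_eq]
    exact expSummable_gamma hq0 hq1 x hx⟩
  have h1 : HasSum f (gammaSeries q x) := by
    have := hs.hasSum.prod_fiberwise hcol
    rw [gammaSeries, expSeries, this.tsum_eq]
    exact hs.hasSum
  exact ((Equiv.prodComm ℕ ℕ+).hasSum_iff.2 h1).prod_fiberwise hrow

theorem one_sub_rpow_pos (hq0 : 0 < q) (hq1 : q < 1) {x : ℝ} (hx : 0 < x) : 0 < 1 - q ^ x :=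
  sub_pos.2 (Real.rpow_lt_one hq0.le hq1 hx)

theorem qGamma_eq_exp (hq0 : 0 < q) (hq1 : q < 1) {x : ℝ} (hx : 0 < x) :
    qGamma q x = Real.exp ((1 - x) * Real.log (1 - q) + (gammaSeries q x - gammaSeries q 1)) := by
  have hpos1 : ∀ n : ℕ, 0 < 1 - q ^ (n + 1) := fun n =>
    sub_pos.2 (pow_lt_one₀ hq0.le hq1 n.succ_ne_zero)
  have hposx : ∀ n : ℕ, 0 < 1 - q ^ (x + (n : ℝ)) := fun n =>
    one_sub_rpow_pos hq0 hq1 (by positivity)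
  have hlog : HasSum (fun n : ℕ => Real.log ((1 - q ^ (n + 1)) / (1 - q ^ (x + (n : ℝ)))))
      (gammaSeries q x - gammaSeries q 1) := by
    refine ((hasSum_neg_log_one_sub hq0 hq1 hx).sub
      (hasSum_neg_log_one_sub hq0 hq1 one_pos)).congr_fun fun n => ?_
    rw [Real.log_div (hpos1 n).ne' (hposx n).ne', add_comm (1 : ℝ), ← Nat.cast_succ,
      Real.rpow_natCast]
    ring
  rw [qGamma, ← Real.rexp_tsum_eq_tprod (fun n => div_pos (hpos1 n) (hposx n)) hlog.summable,
    hlog.tsum_eq, Real.exp_add, Real.rpow_def_of_pos (sub_pos.2 hq1), mul_comm (Real.log _)]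

theorem qGamma_pos (hq0 : 0 < q) (hq1 : q < 1) {x : ℝ} (hx : 0 < x) : 0 < qGamma q x :=
  qGamma_eq_exp hq0 hq1 hx ▸ Real.exp_pos _

theorem log_qGamma (hq0 : 0 < q) (hq1 : q < 1) {x : ℝ} (hx : 0 < x) :
    Real.log (qGamma q x) =
      (1 - x) * Real.log (1 - q) + (gammaSeries q x - gammaSeries q 1) := by
  rw [qGamma_eq_exp hq0 hq1 hx, Real.log_exp]

/-! ### The logarithm of a product of `q`-gamma functions -/

variable {p s : ℕ} {A α a : Fin p → ℝ} {B β b : Fin s → ℝ}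

/-- The points `n * A i * log (1/q)`, indexed by the pairs `(n, i)`. -/
noncomputable def rate (q : ℝ) (A : Fin p → ℝ) (z : ℕ+ × Fin p) : ℝ :=
  z.1 * A z.2 * Real.log (1 / q)

/-- The masses of `discreteMeasure`, indexed by the pairs `(n, i)`. -/
noncomputable def pairMass (q : ℝ) (A α a : Fin p → ℝ) (z : ℕ+ × Fin p) : ℝ :=
  mass q A α a z.1 z.2

/-- The coefficients of the exponential series of `∑ i, α i * log Γ_q(A i x + a i)`. -/
noncomputable def logCoeff (q : ℝ) (α a : Fin p → ℝ) (z : ℕ+ × Fin p) : ℝ :=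
  α z.2 * (gammaCoeff q z.1 * Real.exp (-(a z.2 * gammaRate q z.1)))

theorem log_one_div_pos (hq0 : 0 < q) (hq1 : q < 1) : 0 < Real.log (1 / q) :=
  Real.log_pos (one_lt_one_div hq0 hq1)

theorem rate_pos (hq0 : 0 < q) (hq1 : q < 1) (hA : ∀ i, 0 < A i) (z : ℕ+ × Fin p) :
    0 < rate q A z := by
  have h1 := log_one_div_pos hq0 hq1
  have h2 : (0 : ℝ) < z.1 := by exact_mod_cast z.1.pos
  have h3 := hA z.2
  unfold rate; positivity

theorem pairMass_pos (hq0 : 0 < q) (hq1 : q < 1) (hA : ∀ i, 0 < A i) (hα : ∀ i, 0 < α i)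
    (z : ℕ+ × Fin p) : 0 < pairMass q A α a z := by
  have h1 := one_sub_pow_pnat_pos hq0 hq1 z.1
  have h2 : (0 : ℝ) < z.1 := by exact_mod_cast z.1.pos
  have h3 := hA z.2
  have h4 := hα z.2
  unfold pairMass mass; positivity

/-- Two differentiations turn the coefficients of `log Γ_q` into the masses of the measure. -/
theorem neg_rate_sq_mul_logCoeff (hq0 : 0 < q) (hq1 : q < 1) (z : ℕ+ × Fin p) :
    -rate q A z * (-rate q A z * logCoeff q α a z) = Real.log q ^ 2 * pairMass q A α a z := by
  have h1 := (one_sub_pow_pnat_pos hq0 hq1 z.1).ne'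
  have h2 : (z.1 : ℝ) ≠ 0 := by exact_mod_cast z.1.ne_zero
  have h3 : Real.exp (-(a z.2 * gammaRate q z.1)) = q ^ ((z.1 : ℝ) * a z.2) := by
    rw [exp_neg_mul_gammaRate hq0, ← Real.rpow_natCast, ← Real.rpow_mul hq0.le, mul_comm]
  rw [logCoeff, h3, rate, pairMass, mass, gammaCoeff, one_div q, Real.log_inv]
  field_simp

theorem hasSum_logCoeff (hq0 : 0 < q) (hq1 : q < 1) (hA : ∀ i, 0 < A i) (hα : ∀ i, 0 < α i)
    (ha : ∀ i, 0 ≤ a i) {x : ℝ} (hx : 0 < x) :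
    HasSum (fun z => logCoeff q α a z * Real.exp (-(x * rate q A z)))
      (∑ i, α i * gammaSeries q (A i * x + a i)) := by
  let f : Fin p × ℕ+ → ℝ := fun z =>
    logCoeff q α a (z.2, z.1) * Real.exp (-(x * rate q A (z.2, z.1)))
  have hf0 : 0 ≤ f := fun z => by
    have h1 := hα z.1
    have h2 := gammaCoeff_pos hq0 hq1 z.2
    simp only [f, logCoeff, Pi.zero_apply]; positivity
  have hrow : ∀ i, HasSum (fun k => f (i, k)) (α i * gammaSeries q (A i * x + a i)) := by
    intro i
    have hy : 0 < A i * x + a i := add_pos_of_pos_of_nonneg (mul_pos (hA i) hx) (ha i)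
    refine (((expSummable_gamma hq0 hq1 _ hy).hasSum).mul_left (α i)).congr_fun fun k => ?_
    simp only [f, logCoeff, rate]
    rw [mul_assoc, mul_assoc, ← Real.exp_add, gammaRate]
    ring_nf
  have hs : Summable f :=
    (summable_prod_of_nonneg hf0).2 ⟨fun i => (hrow i).summable, Summable.of_finite⟩
  have h1 : HasSum f (∑ i, α i * gammaSeries q (A i * x + a i)) := by
    rw [← (hs.hasSum.prod_fiberwise hrow).unique (hasSum_fintype _)]
    exact hs.hasSum
  exact (Equiv.prodComm ℕ+ (Fin p)).hasSum_iff.2 h1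

theorem expSummable_logCoeff (hq0 : 0 < q) (hq1 : q < 1) (hA : ∀ i, 0 < A i) (hα : ∀ i, 0 < α i)
    (ha : ∀ i, 0 ≤ a i) : ExpSummable (logCoeff q α a) (rate q A) :=
  fun _ hx => (hasSum_logCoeff hq0 hq1 hA hα ha hx).summable

theorem expSummable_pairMass (hq0 : 0 < q) (hq1 : q < 1) (hA : ∀ i, 0 < A i) (hα : ∀ i, 0 < α i)
    (ha : ∀ i, 0 ≤ a i) : ExpSummable (pairMass q A α a) (rate q A) := by
  have hl := fun z => (rate_pos hq0 hq1 hA z).le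
  have h := ((expSummable_logCoeff hq0 hq1 hA hα ha).neg_mul hl).neg_mul hl
  intro x hx
  have hq : Real.log q ^ 2 ≠ 0 := pow_ne_zero _ (Real.log_neg hq0 hq1).ne
  have h' := h x hx
  simp only [neg_rate_sq_mul_logCoeff hq0 hq1, mul_assoc] at h'
  exact (summable_mul_left_iff hq).1 h'

theorem prod_qGamma_pos (hq0 : 0 < q) (hq1 : q < 1) (hA : ∀ i, 0 < A i) (ha : ∀ i, 0 ≤ a i)
    {x : ℝ} (hx : 0 < x) : 0 < ∏ i, qGamma q (A i * x + a i) ^ α i :=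
  Finset.prod_pos fun i _ => Real.rpow_pos_of_pos
    (qGamma_pos hq0 hq1 (add_pos_of_pos_of_nonneg (mul_pos (hA i) hx) (ha i))) _

/-- The logarithm of `∏ i, Γ_q(A i x + a i)^(α i)` is an affine function plus an exponential
series. -/
theorem exists_log_prod_qGamma (hq0 : 0 < q) (hq1 : q < 1) (hA : ∀ i, 0 < A i)
    (hα : ∀ i, 0 < α i) (ha : ∀ i, 0 ≤ a i) :
    ∃ u v : ℝ, ∀ x : ℝ, 0 < x → Real.log (∏ i, qGamma q (A i * x + a i) ^ α i) =
      u + x * v + expSeries (logCoeff q α a) (rate q A) x := by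
  refine ⟨∑ i, α i * ((1 - a i) * Real.log (1 - q) - gammaSeries q 1),
    ∑ i, -(α i * (A i * Real.log (1 - q))), fun x hx => ?_⟩
  have hy : ∀ i, 0 < A i * x + a i := fun i =>
    add_pos_of_pos_of_nonneg (mul_pos (hA i) hx) (ha i)
  rw [Real.log_prod fun i _ => (Real.rpow_pos_of_pos (qGamma_pos hq0 hq1 (hy i)) _).ne',
    expSeries, (hasSum_logCoeff hq0 hq1 hA hα ha hx).tsum_eq, Finset.mul_sum,
    ← Finset.sum_add_distrib, ← Finset.sum_add_distrib]
  refine Finset.sum_congr rfl fun i _ => ?_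
  rw [Real.log_rpow (qGamma_pos hq0 hq1 (hy i)), log_qGamma hq0 hq1 (hy i)]
  ring

theorem discreteMeasure_eq_atomicMeasure :
    discreteMeasure q A α a = atomicMeasure (pairMass q A α a) (rate q A) := by
  ext E hE
  rw [discreteMeasure, atomicMeasure, Measure.sum_apply _ hE, Measure.finsetSum_apply,
    ← (Equiv.prodComm (Fin p) ℕ+).tsum_eq, ENNReal.tsum_prod', tsum_fintype]
  refine Finset.sum_congr rfl fun i _ => ?_
  rw [Measure.sum_apply _ hE]
  rfl

theorem massAt_eq_tsum_indicator (t : ℝ) :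
    massAt q A α a t = ∑' z, {z | rate q A z = t}.indicator (pairMass q A α a) z :=
  tsum_subtype {z | rate q A z = t} (pairMass q A α a)

theorem massPoints_eq_range : massPoints q A = Set.range (rate q A) := by
  ext t
  simp [massPoints, rate, Prod.exists]

/-! ### The ratio of products of `q`-gamma functions -/

theorem massAt_pos_of_mem (hq0 : 0 < q) (hq1 : q < 1) (hA : ∀ i, 0 < A i) (hα : ∀ i, 0 < α i)
    (ha : ∀ i, 0 ≤ a i) {t : ℝ} (ht : t ∈ massPoints q A) : 0 < massAt q A α a t := by
  have hc := pairMass_pos (a := a) hq0 hq1 hA hα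
  obtain ⟨z, rfl⟩ := massPoints_eq_range (q := q) ▸ ht
  have h : 0 < atomicMeasure (pairMass q A α a) (rate q A) {rate q A z} := by
    refine lt_of_lt_of_le ?_ (Measure.le_iff'.1 (Measure.le_sum _ z) _)
    simpa using hc z
  rw [atomicMeasure_singleton (fun z => (hc z).le) (expSummable_pairMass hq0 hq1 hA hα ha),
    ENNReal.ofReal_pos] at h
  rwa [massAt_eq_tsum_indicator]

theorem massAt_eq_zero_of_notMem {t : ℝ} (ht : t ∉ massPoints q A) : massAt q A α a t = 0 := by
  rw [massPoints_eq_range] at ht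
  rw [massAt_eq_tsum_indicator]
  have h0 : ∀ z, {z | rate q A z = t}.indicator (pairMass q A α a) z = 0 := fun z => by
    rw [Set.indicator_of_notMem]
    exact fun hz => ht ⟨z, hz⟩
  simp only [h0, tsum_zero]

theorem massAt_nonneg (hq0 : 0 < q) (hq1 : q < 1) (hA : ∀ i, 0 < A i) (hα : ∀ i, 0 < α i)
    (t : ℝ) : 0 ≤ massAt q A α a t :=
  tsum_nonneg fun z => (pairMass_pos hq0 hq1 hA hα z.1).le

theorem discreteMeasure_singleton (hq0 : 0 < q) (hq1 : q < 1) (hA : ∀ i, 0 < A i)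
    (hα : ∀ i, 0 < α i) (ha : ∀ i, 0 ≤ a i) (t : ℝ) :
    discreteMeasure q A α a {t} = ENNReal.ofReal (massAt q A α a t) := by
  rw [discreteMeasure_eq_atomicMeasure, massAt_eq_tsum_indicator,
    atomicMeasure_singleton (fun z => (pairMass_pos hq0 hq1 hA hα z).le)
      (expSummable_pairMass hq0 hq1 hA hα ha)]

/-- A point of `massPoints q B` outside `massPoints q A` would carry a positive mass on the left
and none on the right, so the inequality of the masses contains the inclusion of the points. -/
theorem massAt_le_iff (hq0 : 0 < q) (hq1 : q < 1)
    (hA : ∀ i, 0 < A i) (hα : ∀ i, 0 < α i)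
    (hB : ∀ j, 0 < B j) (hβ : ∀ j, 0 < β j) (hb : ∀ j, 0 ≤ b j) :
    (∀ t, massAt q B β b t ≤ massAt q A α a t) ↔
      massPoints q B ⊆ massPoints q A ∧
        ∀ t ∈ massPoints q B, massAt q B β b t ≤ massAt q A α a t := by
  constructor
  · refine fun h => ⟨fun t ht => ?_, fun t _ => h t⟩
    by_contra hn
    have h1 := massAt_pos_of_mem hq0 hq1 hB hβ hb ht
    have h2 := h t
    rw [massAt_eq_zero_of_notMem hn] at h2
    exact absurd h1 h2.not_gt
  · rintro ⟨-, h⟩ t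
    by_cases ht : t ∈ massPoints q B
    · exact h t ht
    · rw [massAt_eq_zero_of_notMem ht]
      exact massAt_nonneg hq0 hq1 hA hα t

/-- The points with `m = 1` already give `B j = n j * A (i j)`; multiples of them follow. -/
theorem massPoints_subset_iff (hq0 : 0 < q) (hq1 : q < 1) :
    massPoints q B ⊆ massPoints q A ↔
      ∃ (n : Fin s → ℕ+) (i : Fin s → Fin p), ∀ j, B j = (n j : ℝ) * A (i j) := by
  have hL := (log_one_div_pos hq0 hq1).ne'
  constructor
  · intro h
    have h1 : ∀ j, ∃ (n : ℕ+) (i : Fin p), B j = (n : ℝ) * A i := by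
      intro j
      obtain ⟨n, i, hn⟩ := h ⟨1, j, rfl⟩
      exact ⟨n, i, by simpa [hL] using (mul_right_cancel₀ hL hn).symm⟩
    choose n i hni using h1
    exact ⟨n, i, hni⟩
  · rintro ⟨n, i, h⟩ t ⟨m, j, rfl⟩
    refine ⟨m * n j, i j, ?_⟩
    rw [h j, PNat.mul_coe, Nat.cast_mul]
    ring

theorem massAt_le_of_diffNonneg (hq0 : 0 < q) (hq1 : q < 1)
    (hA : ∀ i, 0 < A i) (hα : ∀ i, 0 < α i) (ha : ∀ i, 0 ≤ a i)
    (hB : ∀ j, 0 < B j) (hβ : ∀ j, 0 < β j) (hb : ∀ j, 0 ≤ b j)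
    (h : DiffNonneg (discreteMeasure q A α a) (discreteMeasure q B β b)) (t : ℝ) :
    massAt q B β b t ≤ massAt q A α a t := by
  have h1 := h {t} (measurableSet_singleton t) Bornology.isBounded_singleton
  rwa [diffMeasure, discreteMeasure_singleton hq0 hq1 hA hα ha,
    discreteMeasure_singleton hq0 hq1 hB hβ hb,
    ENNReal.toReal_ofReal (massAt_nonneg hq0 hq1 hA hα t),
    ENNReal.toReal_ofReal (massAt_nonneg hq0 hq1 hB hβ t), sub_nonneg] at h1

theorem exists_add_eq_of_massAt_le (hq0 : 0 < q) (hq1 : q < 1)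
    (hA : ∀ i, 0 < A i) (hα : ∀ i, 0 < α i) (ha : ∀ i, 0 ≤ a i)
    (hB : ∀ j, 0 < B j) (hβ : ∀ j, 0 < β j) (hb : ∀ j, 0 ≤ b j)
    (h : ∀ t, massAt q B β b t ≤ massAt q A α a t) :
    ∃ τ : Measure ℝ, τ + discreteMeasure q B β b = discreteMeasure q A α a := by
  refine exists_add_eq_of_countable
    ((Set.countable_range (rate q A)).union (Set.countable_range (rate q B))) ?_ ?_ fun t => ?_
  · rw [discreteMeasure_eq_atomicMeasure]
    exact measure_mono_null (Set.compl_subset_compl.2 Set.subset_union_left)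
      atomicMeasure_compl_range
  · rw [discreteMeasure_eq_atomicMeasure]
    exact measure_mono_null (Set.compl_subset_compl.2 Set.subset_union_right)
      atomicMeasure_compl_range
  · rw [discreteMeasure_singleton hq0 hq1 hA hα ha, discreteMeasure_singleton hq0 hq1 hB hβ hb]
    exact ENNReal.ofReal_le_ofReal (h t)

theorem ratioW_pos (hq0 : 0 < q) (hq1 : q < 1) (hA : ∀ i, 0 < A i) (ha : ∀ i, 0 ≤ a i)
    (hB : ∀ j, 0 < B j) (hb : ∀ j, 0 ≤ b j) {x : ℝ} (hx : 0 < x) :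
    0 < ratioW q A α a B β b x :=
  div_pos (prod_qGamma_pos hq0 hq1 hA ha hx) (prod_qGamma_pos hq0 hq1 hB hb hx)

theorem exists_log_ratioW (hq0 : 0 < q) (hq1 : q < 1)
    (hA : ∀ i, 0 < A i) (hα : ∀ i, 0 < α i) (ha : ∀ i, 0 ≤ a i)
    (hB : ∀ j, 0 < B j) (hβ : ∀ j, 0 < β j) (hb : ∀ j, 0 ≤ b j) :
    ∃ u v : ℝ, ∀ x : ℝ, 0 < x → Real.log (ratioW q A α a B β b x) =
      u + x * v + (expSeries (logCoeff q α a) (rate q A) x -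
        expSeries (logCoeff q β b) (rate q B) x) := by
  obtain ⟨u, v, h⟩ := exists_log_prod_qGamma hq0 hq1 hA hα ha
  obtain ⟨u', v', h'⟩ := exists_log_prod_qGamma hq0 hq1 hB hβ hb
  refine ⟨u - u', v - v', fun x hx => ?_⟩
  rw [ratioW, Real.log_div (prod_qGamma_pos hq0 hq1 hA ha hx).ne'
    (prod_qGamma_pos hq0 hq1 hB hb hx).ne', h x hx, h' x hx]
  ring

theorem contDiffOn_log_ratioW (hq0 : 0 < q) (hq1 : q < 1)
    (hA : ∀ i, 0 < A i) (hα : ∀ i, 0 < α i) (ha : ∀ i, 0 ≤ a i)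
    (hB : ∀ j, 0 < B j) (hβ : ∀ j, 0 < β j) (hb : ∀ j, 0 ≤ b j) :
    ContDiffOn ℝ ∞ (fun x => Real.log (ratioW q A α a B β b x)) (Set.Ioi 0) := by
  obtain ⟨u, v, h⟩ := exists_log_ratioW hq0 hq1 hA hα ha hB hβ hb
  have h1 := (expSummable_logCoeff hq0 hq1 hA hα ha).contDiffOn
    fun z => (rate_pos hq0 hq1 hA z).le
  have h2 := (expSummable_logCoeff hq0 hq1 hB hβ hb).contDiffOn
    fun z => (rate_pos hq0 hq1 hB z).le
  have h3 : ContDiff ℝ ∞ fun x : ℝ => u + x * v := by fun_prop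
  exact (h3.contDiffOn.add (h1.sub h2)).congr fun x hx => h x hx

theorem logW''_eq (hq0 : 0 < q) (hq1 : q < 1)
    (hA : ∀ i, 0 < A i) (hα : ∀ i, 0 < α i) (ha : ∀ i, 0 ≤ a i)
    (hB : ∀ j, 0 < B j) (hβ : ∀ j, 0 < β j) (hb : ∀ j, 0 ≤ b j) {x : ℝ} (hx : 0 < x) :
    logW'' q A α a B β b x = Real.log q ^ 2 *
      (expSeries (pairMass q A α a) (rate q A) x - expSeries (pairMass q B β b) (rate q B) x) := by
  obtain ⟨u, v, h⟩ := exists_log_ratioW hq0 hq1 hA hα ha hB hβ hb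
  have hlA := fun z => (rate_pos hq0 hq1 hA z).le
  have hlB := fun z => (rate_pos hq0 hq1 hB z).le
  have hsA := expSummable_logCoeff hq0 hq1 hA hα ha
  have hsB := expSummable_logCoeff hq0 hq1 hB hβ hb
  have h1 : ∀ y : ℝ, 0 < y → deriv (fun x => Real.log (ratioW q A α a B β b x)) y =
      v + (expSeries (fun z => -rate q A z * logCoeff q α a z) (rate q A) y -
        expSeries (fun z => -rate q B z * logCoeff q β b z) (rate q B) y) := by
    intro y hy
    have he : (fun x => Real.log (ratioW q A α a B β b x)) =ᶠ[𝓝 y] fun x => u + x * v +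
        (expSeries (logCoeff q α a) (rate q A) x - expSeries (logCoeff q β b) (rate q B) x) :=
      (eventually_gt_nhds hy).mono h
    rw [he.deriv_eq]
    exact (((hasDerivAt_mul_const v).const_add u).add
      ((hsA.hasDerivAt hlA hy).sub (hsB.hasDerivAt hlB hy))).deriv
  have he : deriv (fun x => Real.log (ratioW q A α a B β b x)) =ᶠ[𝓝 x] _ :=
    (eventually_gt_nhds hx).mono h1
  rw [logW'', iteratedDeriv_succ, iteratedDeriv_one, he.deriv_eq]
  refine ((((hsA.neg_mul hlA).hasDerivAt hlA hx).sub
    ((hsB.neg_mul hlB).hasDerivAt hlB hx)).const_add v).deriv.trans ?_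
  simp only [expSeries, neg_rate_sq_mul_logCoeff hq0 hq1, mul_assoc, tsum_mul_left, mul_sub]

/-- The derivatives of `(log W_q)''` are, up to the sign `(-1)^n`, differences of exponential
series with coefficients `rate ^ n * mass`. -/
theorem neg_one_pow_mul_iteratedDeriv_logW'' (hq0 : 0 < q) (hq1 : q < 1)
    (hA : ∀ i, 0 < A i) (hα : ∀ i, 0 < α i) (ha : ∀ i, 0 ≤ a i)
    (hB : ∀ j, 0 < B j) (hβ : ∀ j, 0 < β j) (hb : ∀ j, 0 ≤ b j) (n : ℕ) {x : ℝ} (hx : 0 < x) :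
    (-1) ^ n * iteratedDeriv n (logW'' q A α a B β b) x = Real.log q ^ 2 *
      (expSeries (fun z => rate q A z ^ n * pairMass q A α a z) (rate q A) x -
        expSeries (fun z => rate q B z ^ n * pairMass q B β b z) (rate q B) x) := by
  have he : logW'' q A α a B β b =ᶠ[𝓝 x] fun y => Real.log q ^ 2 *
      (expSeries (pairMass q A α a) (rate q A) - expSeries (pairMass q B β b) (rate q B)) y :=
    (eventually_gt_nhds hx).mono fun y hy => logW''_eq hq0 hq1 hA hα ha hB hβ hb hy
  have hlA := rate_pos hq0 hq1 hA
  have hlB := rate_pos hq0 hq1 hB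
  have hsA := expSummable_pairMass hq0 hq1 hA hα ha
  have hsB := expSummable_pairMass hq0 hq1 hB hβ hb
  rw [he.iteratedDeriv_eq, iteratedDeriv_const_mul_field,
    iteratedDeriv_sub (hsA.contDiffAt hlA n hx) (hsB.contDiffAt hlB n hx),
    ← hsA.neg_one_pow_mul_iteratedDeriv hlA n hx, ← hsB.neg_one_pow_mul_iteratedDeriv hlB n hx]
  ring

/-- Complete monotonicity forces the inequality of the masses: at a point `t > 0` the scaled
derivatives of order `n` at `n / t` are non-negative and converge to the difference of the
masses at `t`. -/
theorem massAt_le_of_completelyMonotonic (hq0 : 0 < q) (hq1 : q < 1)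
    (hA : ∀ i, 0 < A i) (hα : ∀ i, 0 < α i) (ha : ∀ i, 0 ≤ a i)
    (hB : ∀ j, 0 < B j) (hβ : ∀ j, 0 < β j) (hb : ∀ j, 0 ≤ b j)
    (h : CompletelyMonotonic (logW'' q A α a B β b)) (t : ℝ) :
    massAt q B β b t ≤ massAt q A α a t := by
  have hq : 0 < Real.log q ^ 2 := sq_pos_of_neg (Real.log_neg hq0 hq1)
  have hlA := rate_pos hq0 hq1 hA
  have hlB := rate_pos hq0 hq1 hB
  rcases le_or_gt t 0 with ht | ht
  -- All points are positive, so there is no mass at `t ≤ 0`.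
  · rw [massAt_eq_zero_of_notMem (A := B)]
    · exact massAt_nonneg hq0 hq1 hA hα t
    · rw [massPoints_eq_range]
      rintro ⟨z, rfl⟩
      exact ht.not_gt (hlB z)
  have hlim := ((expSummable_pairMass hq0 hq1 hA hα ha).tendsto_coefficient
    (fun z => (hlA z).le) ht).sub ((expSummable_pairMass hq0 hq1 hB hβ hb).tendsto_coefficient
    (fun z => (hlB z).le) ht)
  rw [← massAt_eq_tsum_indicator, ← massAt_eq_tsum_indicator] at hlim
  refine sub_nonneg.1 (ge_of_tendsto hlim ?_)
  filter_upwards [eventually_gt_atTop 0] with n hn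
  have hn' : (0 : ℝ) < n := by exact_mod_cast hn
  have h1 := h.2 n (n / t) (by positivity)
  rw [neg_one_pow_mul_iteratedDeriv_logW'' hq0 hq1 hA hα ha hB hβ hb n (by positivity)] at h1
  rw [← mul_sub]
  exact mul_nonneg (by positivity) (nonneg_of_mul_nonneg_right h1 hq)

theorem completelyMonotonic_of_add_eq (hq0 : 0 < q) (hq1 : q < 1)
    (hA : ∀ i, 0 < A i) (hα : ∀ i, 0 < α i) (ha : ∀ i, 0 ≤ a i)
    (hB : ∀ j, 0 < B j) (hβ : ∀ j, 0 < β j) (hb : ∀ j, 0 ≤ b j) {τ : Measure ℝ}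
    (h : τ + discreteMeasure q B β b = discreteMeasure q A α a) :
    CompletelyMonotonic (logW'' q A α a B β b) := by
  have hlA := rate_pos hq0 hq1 hA
  have hlB := rate_pos hq0 hq1 hB
  have hsA := expSummable_pairMass hq0 hq1 hA hα ha
  have hsB := expSummable_pairMass hq0 hq1 hB hβ hb
  have hcA := fun z => (pairMass_pos (a := a) hq0 hq1 hA hα z).le
  have hcB := fun z => (pairMass_pos (a := b) hq0 hq1 hB hβ z).le
  refine ⟨?_, fun n x hx => ?_⟩
  · exact (contDiffOn_const.mul ((hsA.contDiffOn fun z => (hlA z).le).sub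
      (hsB.contDiffOn fun z => (hlB z).le))).congr
        fun x hx => logW''_eq hq0 hq1 hA hα ha hB hβ hb hx
  · rw [neg_one_pow_mul_iteratedDeriv_logW'' hq0 hq1 hA hα ha hB hβ hb n hx,
      ← setIntegral_pow_mul_exp hcA hlA hsA n hx, ← setIntegral_pow_mul_exp hcB hlB hsB n hx]
    rw [discreteMeasure_eq_atomicMeasure, discreteMeasure_eq_atomicMeasure] at h
    refine mul_nonneg (sq_nonneg _) (sub_nonneg.2 (integral_mono_measure
      (Measure.restrict_mono_measure (h ▸ Measure.le_add_left le_rfl) _) ?_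
      (integrableOn_pow_mul_exp hcA hlA hsA n hx)))
    refine ae_restrict_of_forall_mem measurableSet_Ioi fun y hy => ?_
    exact mul_nonneg (pow_nonneg (le_of_lt hy) n) (Real.exp_pos _).le

end QGammaRatio

theorem mainTheorem2 (q : ℝ) (hq0 : 0 < q) (hq1 : q < 1) {p s : ℕ}
    (A α a : Fin p → ℝ) (B β b : Fin s → ℝ)
    (hA : ∀ i, 0 < A i) (hα : ∀ i, 0 < α i) (ha : ∀ i, 0 ≤ a i)
    (hB : ∀ j, 0 < B j) (hβ : ∀ j, 0 < β j) (hb : ∀ j, 0 ≤ b j)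
    (μ σ : MeasureTheory.Measure ℝ)
    (hμ : μ = QGammaRatio.discreteMeasure q A α a)
    (hσ : σ = QGammaRatio.discreteMeasure q B β b) :
    -- `W_q` is positive, `log W_q` is smooth on `(0, ∞)`
    (∀ x : ℝ, 0 < x → 0 < QGammaRatio.ratioW q A α a B β b x) ∧
    ContDiffOn ℝ ∞ (fun x => Real.log (QGammaRatio.ratioW q A α a B β b x)) (Set.Ioi 0) ∧
    -- `μ`, `σ` are finite on bounded sets, so that `τ = μ - σ` is defined there
    (∀ E : Set ℝ, Bornology.IsBounded E → μ E < ⊤ ∧ σ E < ⊤) ∧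
    -- `(log W_q)''` is `(log q)^2` times the Laplace transform of `τ = μ - σ`
    (∀ x : ℝ, 0 < x →
      QGammaRatio.LaplaceConverges μ x ∧ QGammaRatio.LaplaceConverges σ x ∧
      QGammaRatio.logW'' q A α a B β b x =
        Real.log q ^ 2 * (QGammaRatio.laplace μ x - QGammaRatio.laplace σ x)) ∧
    -- complete monotonicity is equivalent to `τ ≥ 0`
    (QGammaRatio.CompletelyMonotonic (QGammaRatio.logW'' q A α a B β b) ↔
      QGammaRatio.DiffNonneg μ σ) ∧
    -- `τ ≥ 0` is equivalent to conditions (1) and (2)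
    (QGammaRatio.DiffNonneg μ σ ↔
      QGammaRatio.massPoints q B ⊆ QGammaRatio.massPoints q A ∧
      ∀ t ∈ QGammaRatio.massPoints q B,
        QGammaRatio.massAt q B β b t ≤ QGammaRatio.massAt q A α a t) ∧
    -- the two forms of condition (1) are equivalent
    (QGammaRatio.massPoints q B ⊆ QGammaRatio.massPoints q A ↔
      ∃ (n : Fin s → ℕ+) (i : Fin s → Fin p), ∀ j, B j = (n j : ℝ) * A (i j)) ∧
    -- if `τ ≥ 0`, then `τ` extends to a measure, and `(log W_q)''` is `(log q)^2` times its
    -- Laplace transform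
    (QGammaRatio.DiffNonneg μ σ →
      ∃ τ : MeasureTheory.Measure ℝ,
        (∀ E : Set ℝ, MeasurableSet E → Bornology.IsBounded E →
          τ E = ENNReal.ofReal (QGammaRatio.diffMeasure μ σ E)) ∧
        ∀ x : ℝ, 0 < x →
          QGammaRatio.LaplaceConverges τ x ∧
          QGammaRatio.logW'' q A α a B β b x = Real.log q ^ 2 * QGammaRatio.laplace τ x) := by
  have hcA := fun z => (QGammaRatio.pairMass_pos (a := a) hq0 hq1 hA hα z).le
  have hcB := fun z => (QGammaRatio.pairMass_pos (a := b) hq0 hq1 hB hβ z).le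
  have hlA := QGammaRatio.rate_pos hq0 hq1 hA
  have hlB := QGammaRatio.rate_pos hq0 hq1 hB
  have hsA := QGammaRatio.expSummable_pairMass hq0 hq1 hA hα ha
  have hsB := QGammaRatio.expSummable_pairMass hq0 hq1 hB hβ hb
  have hfin : ∀ E : Set ℝ, Bornology.IsBounded E → μ E < ⊤ ∧ σ E < ⊤ := by
    intro E hE
    rw [hμ, hσ, QGammaRatio.discreteMeasure_eq_atomicMeasure,
      QGammaRatio.discreteMeasure_eq_atomicMeasure]
    exact ⟨QGammaRatio.atomicMeasure_lt_top hcA hsA hE,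
      QGammaRatio.atomicMeasure_lt_top hcB hsB hE⟩
  have hlap : ∀ x : ℝ, 0 < x →
      QGammaRatio.LaplaceConverges μ x ∧ QGammaRatio.LaplaceConverges σ x ∧
      QGammaRatio.logW'' q A α a B β b x =
        Real.log q ^ 2 * (QGammaRatio.laplace μ x - QGammaRatio.laplace σ x) := by
    intro x hx
    rw [hμ, hσ, QGammaRatio.discreteMeasure_eq_atomicMeasure,
      QGammaRatio.discreteMeasure_eq_atomicMeasure,
      QGammaRatio.laplace_atomicMeasure hcA hlA hsA hx,
      QGammaRatio.laplace_atomicMeasure hcB hlB hsB hx]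
    exact ⟨QGammaRatio.laplaceConverges_atomicMeasure hcA hlA hsA hx,
      QGammaRatio.laplaceConverges_atomicMeasure hcB hlB hsB hx,
      QGammaRatio.logW''_eq hq0 hq1 hA hα ha hB hβ hb hx⟩
  have hadd : (∀ t, QGammaRatio.massAt q B β b t ≤ QGammaRatio.massAt q A α a t) →
      ∃ τ : MeasureTheory.Measure ℝ, τ + σ = μ := by
    rw [hμ, hσ]
    exact QGammaRatio.exists_add_eq_of_massAt_le hq0 hq1 hA hα ha hB hβ hb
  have hmass : QGammaRatio.DiffNonneg μ σ →
      ∀ t, QGammaRatio.massAt q B β b t ≤ QGammaRatio.massAt q A α a t := by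
    rw [hμ, hσ]
    exact QGammaRatio.massAt_le_of_diffNonneg hq0 hq1 hA hα ha hB hβ hb
  have hnonneg : (∀ t, QGammaRatio.massAt q B β b t ≤ QGammaRatio.massAt q A α a t) →
      QGammaRatio.DiffNonneg μ σ := fun h =>
    (hadd h).elim fun _ hτ => QGammaRatio.diffNonneg_of_add_eq (fun E hE => (hfin E hE).1) hτ
  refine ⟨fun x hx => QGammaRatio.ratioW_pos hq0 hq1 hA ha hB hb hx,
    QGammaRatio.contDiffOn_log_ratioW hq0 hq1 hA hα ha hB hβ hb, hfin, hlap, ⟨fun h => ?_,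
    fun h => ?_⟩, ?_, QGammaRatio.massPoints_subset_iff hq0 hq1, fun h => ?_⟩
  · exact hnonneg
      (QGammaRatio.massAt_le_of_completelyMonotonic hq0 hq1 hA hα ha hB hβ hb h)
  · obtain ⟨τ, hτ⟩ := hadd (hmass h)
    rw [hμ, hσ] at hτ
    exact QGammaRatio.completelyMonotonic_of_add_eq hq0 hq1 hA hα ha hB hβ hb hτ
  · rw [← QGammaRatio.massAt_le_iff hq0 hq1 hA hα hB hβ hb]
    exact ⟨hmass, hnonneg⟩
  · obtain ⟨τ, hτ⟩ := hadd (hmass h)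
    refine ⟨τ, fun E _ hE => QGammaRatio.apply_eq_ofReal_diffMeasure hτ (hfin E hE).1,
      fun x hx => ?_⟩
    obtain ⟨h1, -, h3⟩ := hlap x hx
    obtain ⟨h4, h5⟩ := QGammaRatio.laplace_eq_sub_of_add_eq hτ h1
    exact ⟨h4, h5 ▸ h3⟩
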